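/- Let $\mathbb{K}=\mathbb{R}$ or $\mathbb{C}$, let $\mathbb{M}_{M,N}$ be the space of $M\times N$ matrices over $\mathbb{K}$ with the Frobenius inner product and norm $\|\cdot\|$, let $\mathcal{H}\subset\mathbb{M}_{M,N}$ be a linear subspace, $F\in\mathcal{H}$, $\tau>0$ and $1<q<\infty$. Let $P_{\mathcal{H}}$ and $P_{\mathcal{H}^\perp}$ denote the orthogonal projections onto $\mathcal{H}$ and $\mathcal{H}^\perp$, and let $\sigma_j(A)$ denote the singular values of $A$. For $f:[0,\infty)\to\mathbb{R}$ with $f(0)=0$ and a singular value decomposition $A=U\,\mathrm{diag}(\sigma_j(A))\,V^*$, put $\mathfrak{S}_f(A)=U\,\mathrm{diag}(f(\sigma_j(A)))\,V^*$ (this does not depend on the choice of the decomposition). Put $$s(\sigma)=\max\bigl(\min(\sigma,\tau),\,\sigma/q\bigr),\qquad \mathfrak{B}(W)=\mathfrak{S}_{s}\bigl(qF+P_{\mathcal{H}^\perp}W\bigr),$$ $$\mathcal{R}_\tau(A)=\sum_{j=1}^{\min(M,N)}\Bigl(\tau^2-\max\bigl(\tau-\sigma_j(A),0\bigr)^2\Bigr).$$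 Then: 1. For every starting point $W^1\in\mathbb{M}_{M,N}$, the Picard iteration $W^{n+1}=\mathfrak{B}(W^n)$ converges to a fixed point $W^\circ$ of $\mathfrak{B}$. 2. $P_{\mathcal{H}}(W^\circ)$ is the same for every fixed point $W^\circ$ of $\mathfrak{B}$. 3. For every fixed point $W^\circ$ of $\mathfrak{B}$, the matrix $$A^\circ=\frac{1}{q-1}\bigl(qF-P_{\mathcal{H}}(W^\circ)\bigr)$$ belongs to $\mathcal{H}$ and is the unique minimizer of $\mathcal{R}_\tau(A)+q\|A-F\|^2$ over $A\in\mathcal{H}$. -/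

import Mathlib

open Matrix Filter Topology

/- Matrices carry the Frobenius norm throughout. -/
attribute [local instance] Matrix.frobeniusNormedAddCommGroup Matrix.frobeniusNormedSpace

/-- The Frobenius inner product `⟪A, B⟫ = tr (Aᴴ B)`; the norm it induces is the Frobenius norm. -/
noncomputable abbrev frobeniusInnerProductSpace {𝕜 : Type*} [RCLike 𝕜] {m n : Type*}
    [Fintype m] [Fintype n] : InnerProductSpace 𝕜 (Matrix m n 𝕜) where
  inner A B := (Aᴴ * B).trace
  norm_sq_eq_re_inner A := by
    rw [Matrix.frobenius_norm_def, ← Real.sqrt_eq_rpow, Real.sq_sqrt (by positivity)]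
    simp only [Matrix.trace, Matrix.diag_apply, Matrix.mul_apply, Matrix.conjTranspose_apply,
      RCLike.star_def, RCLike.conj_mul, map_sum]
    rw [Finset.sum_comm]
    refine Finset.sum_congr rfl fun j _ => Finset.sum_congr rfl fun i _ => ?_
    norm_cast
  conj_inner_symm A B := by
    rw [← RCLike.star_def, ← Matrix.trace_conjTranspose]
    simp
  add_left A B C := by simp [Matrix.add_mul]
  smul_left A B r := by simp

attribute [local instance] frobeniusInnerProductSpace

/-- `σ_j(A)`, the `j`-th singular value of `A` (counted from `j = 0`): the singular values are
listed in decreasing order with multiplicity, and `σ_j(A) = 0` for `j ≥ min M N`. -/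
noncomputable def matSingularValue {𝕜 : Type*} [RCLike 𝕜] {M N : ℕ}
    (A : Matrix (Fin M) (Fin N) 𝕜) (j : ℕ) : ℝ :=
  (Matrix.toEuclideanLin A).singularValues j

/-- The rectangular `M × N` diagonal matrix with diagonal entries `s 0, s 1, …`. -/
def rectDiag (𝕜 : Type*) [RCLike 𝕜] (M N : ℕ) (s : ℕ → ℝ) : Matrix (Fin M) (Fin N) 𝕜 :=
  Matrix.of fun i j => if (i : ℕ) = (j : ℕ) then ((s i : ℝ) : 𝕜) else 0

/-- `A = U diag(σ_j(A)) Vᴴ` is a singular value decomposition of `A`. -/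
structure IsSVD {𝕜 : Type*} [RCLike 𝕜] {M N : ℕ} (A : Matrix (Fin M) (Fin N) 𝕜)
    (U : Matrix (Fin M) (Fin M) 𝕜) (V : Matrix (Fin N) (Fin N) 𝕜) : Prop where
  left_unitary : U ∈ Matrix.unitaryGroup (Fin M) 𝕜
  right_unitary : V ∈ Matrix.unitaryGroup (Fin N) 𝕜
  eq_mul : A = U * rectDiag 𝕜 M N (matSingularValue A) * Vᴴ

/-- Every matrix has a singular value decomposition. -/
theorem exists_isSVD {𝕜 : Type*} [RCLike 𝕜] {M N : ℕ} (A : Matrix (Fin M) (Fin N) 𝕜) :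
    ∃ (U : Matrix (Fin M) (Fin M) 𝕜) (V : Matrix (Fin N) (Fin N) 𝕜), IsSVD A U V := by
  set T := Matrix.toEuclideanLin A with hT
  have hn : Module.finrank 𝕜 (EuclideanSpace 𝕜 (Fin N)) = N := by simp
  set v := T.isSymmetric_adjoint_comp_self.eigenvectorBasis hn with hv
  have hTv : ∀ i j : Fin N, inner 𝕜 (T (v i)) (T (v j)) =
      if i = j then (((T.singularValues j) ^ 2 : ℝ) : 𝕜) else 0 := by
    intro i j
    rw [← LinearMap.adjoint_inner_right, ← LinearMap.comp_apply,
      hv, LinearMap.IsSymmetric.apply_eigenvectorBasis, ← T.sq_singularValues_fin hn,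
      inner_smul_right, orthonormal_iff_ite.mp (OrthonormalBasis.orthonormal _)]
    split_ifs <;> simp
  have hlt : ∀ i : ℕ, T.singularValues i ≠ 0 → i < N ∧ i < M := by
    intro i hi
    have h1 := T.singularValues_pos_iff_lt_finrank_range.mp
      ((T.singularValues_pos_iff_ne_zero i).mpr hi)
    have h2 := LinearMap.finrank_range_le T
    have h3 := Submodule.finrank_le T.range
    simp only [finrank_euclideanSpace, Fintype.card_fin] at h2 h3
    omega
  let w : Fin M → EuclideanSpace 𝕜 (Fin M) := fun i =>
    if h : (i : ℕ) < N then ((T.singularValues i : ℝ) : 𝕜)⁻¹ • T (v ⟨i, h⟩) else 0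
  let S : Set (Fin M) := {i | T.singularValues i ≠ 0}
  have hw : Orthonormal 𝕜 (S.domRestrict w) := by
    rw [orthonormal_iff_ite]
    rintro ⟨i, hi⟩ ⟨j, hj⟩
    have hi' := (hlt _ hi).1
    have hj' := (hlt _ hj).1
    have hj0 : ((T.singularValues j : ℝ) : 𝕜) ≠ 0 := by exact_mod_cast hj
    simp only [Set.domRestrict_apply, w, hi', hj', dif_pos, inner_smul_left, inner_smul_right,
      hTv, Subtype.mk.injEq, Fin.ext_iff]
    split_ifs with h
    · rw [h, map_inv₀, RCLike.conj_ofReal]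
      push_cast
      field_simp
    · simp
  obtain ⟨u, hu⟩ := hw.exists_orthonormalBasis_extension_of_card_eq (by simp)
  let e (n : ℕ) := EuclideanSpace.basisFun (Fin n) 𝕜
  refine ⟨(e M).toBasis.toMatrix u, (e N).toBasis.toMatrix v,
    (e M).toMatrix_orthonormalBasis_mem_unitary u,
    (e N).toMatrix_orthonormalBasis_mem_unitary v, ?_⟩
  have hV := (e N).toMatrix_orthonormalBasis_mem_unitary v
  set V := (e N).toBasis.toMatrix v
  set U := (e M).toBasis.toMatrix u
  have key : A * V = U * rectDiag 𝕜 M N (matSingularValue A) := by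
    ext i j
    have h1 : (A * V) i j = T (v j) i := by
      simp [V, e, hT, Matrix.mul_apply, Matrix.toLpLin_apply, Matrix.mulVec, dotProduct,
        Module.Basis.toMatrix_apply]
    have h2 : (U * rectDiag 𝕜 M N (matSingularValue A)) i j =
        if h : (j : ℕ) < M then u ⟨j, h⟩ i * ((T.singularValues j : ℝ) : 𝕜) else 0 := by
      simp only [Matrix.mul_apply, rectDiag, Matrix.of_apply, matSingularValue]
      split_ifs with h
      · rw [Finset.sum_eq_single ⟨j, h⟩]
        · simp [U, e, Module.Basis.toMatrix_apply, hT]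
        · intro b _ hb
          rw [if_neg (fun h' => hb (Fin.ext h')), mul_zero]
        · simp
      · refine Finset.sum_eq_zero fun b _ => ?_
        rw [if_neg (by omega), mul_zero]
    rw [h1, h2]
    by_cases h0 : T.singularValues j = 0
    · have : T (v j) = 0 := by
        rw [← inner_self_eq_zero (𝕜 := 𝕜), hTv]
        simp [h0]
      rw [this, h0]
      simp
    · have hM := (hlt _ h0).2
      have h0' : ((T.singularValues j : ℝ) : 𝕜) ≠ 0 := by exact_mod_cast h0
      rw [dif_pos hM, hu ⟨j, hM⟩ h0]
      simp only [w, j.isLt, dif_pos, Fin.eta, PiLp.smul_apply, smul_eq_mul]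
      field_simp
  have hVV : V * Vᴴ = 1 := Matrix.mem_unitaryGroup_iff.mp hV
  rw [← key, Matrix.mul_assoc, hVV, Matrix.mul_one]

/-- The singular value functional calculus: `𝔖_f(A) = U diag(f(σ_j(A))) Vᴴ`, where
`A = U diag(σ_j(A)) Vᴴ` is a singular value decomposition of `A`. For `f 0 = 0` the result does
not depend on the decomposition, see `svCalculus_eq`. -/
noncomputable def svCalculus {𝕜 : Type*} [RCLike 𝕜] {M N : ℕ} (f : ℝ → ℝ)
    (A : Matrix (Fin M) (Fin N) 𝕜) : Matrix (Fin M) (Fin N) 𝕜 :=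
  (exists_isSVD A).choose * rectDiag 𝕜 M N (fun j => f (matSingularValue A j)) *
    ((exists_isSVD A).choose_spec.choose)ᴴ

/-- The functional calculus may be computed from any decomposition `A = U diag(s) Vᴴ` with `U`, `V`
unitary and `s ≥ 0`. -/
theorem svCalculus_eq {𝕜 : Type*} [RCLike 𝕜] {M N : ℕ} {f : ℝ → ℝ} (hf : f 0 = 0)
    {A : Matrix (Fin M) (Fin N) 𝕜} {U : Matrix (Fin M) (Fin M) 𝕜} {V : Matrix (Fin N) (Fin N) 𝕜}
    {s : ℕ → ℝ} (hU : U ∈ Matrix.unitaryGroup (Fin M) 𝕜) (hV : V ∈ Matrix.unitaryGroup (Fin N) 𝕜)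
    (hs : ∀ j, 0 ≤ s j) (hA : A = U * rectDiag 𝕜 M N s * Vᴴ) :
    svCalculus f A = U * rectDiag 𝕜 M N (fun j => f (s j)) * Vᴴ := by
  classical
  -- any decomposition expresses the calculus as `A * p(Aᴴ * A)` for one interpolating polynomial `p`
  have key : ∀ (p : Polynomial ℝ) (U : Matrix (Fin M) (Fin M) 𝕜) (V : Matrix (Fin N) (Fin N) 𝕜)
      (s : ℕ → ℝ), U ∈ Matrix.unitaryGroup (Fin M) 𝕜 → V ∈ Matrix.unitaryGroup (Fin N) 𝕜 →
      (∀ j < min M N, s j * p.eval (s j ^ 2) = f (s j)) → A = U * rectDiag 𝕜 M N s * Vᴴ →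
      U * rectDiag 𝕜 M N (fun j => f (s j)) * Vᴴ = A * Polynomial.aeval (Aᴴ * A) p := by
    intro p U V s hU hV hp hA
    have hUU : Uᴴ * U = 1 := Matrix.mem_unitaryGroup_iff'.mp hU
    have hVV : Vᴴ * V = 1 := Matrix.mem_unitaryGroup_iff'.mp hV
    have hVV' : V * Vᴴ = 1 := Matrix.mem_unitaryGroup_iff.mp hV
    have hmul : ∀ g : ℕ → ℝ, rectDiag 𝕜 M N s * Matrix.diagonal (fun j : Fin N => ((g j : ℝ) : 𝕜))
        = rectDiag 𝕜 M N (fun j => s j * g j) := by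
      intro g
      ext i j
      simp only [Matrix.mul_diagonal, rectDiag, Matrix.of_apply]
      split_ifs with h
      · rw [h]; push_cast; rfl
      · simp
    -- `d j` is the `j`-th diagonal entry of the square of the rectangular diagonal matrix
    let d : ℕ → ℝ := fun j => if j < M then s j ^ 2 else 0
    have hsq : (rectDiag 𝕜 M N s)ᴴ * rectDiag 𝕜 M N s =
        Matrix.diagonal (fun j : Fin N => ((d j : ℝ) : 𝕜)) := by
      ext i j
      simp only [Matrix.mul_apply, Matrix.conjTranspose_apply, rectDiag, Matrix.of_apply,
        Matrix.diagonal_apply, d]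
      split_ifs with h1 h2
      · subst h1
        rw [Finset.sum_eq_single ⟨i, h2⟩]
        · simp [sq]
        · intro b _ hb
          have hb' : (b : ℕ) ≠ i := fun h' => hb (Fin.ext h')
          simp [hb']
        · simp
      · rw [RCLike.ofReal_zero]
        refine Finset.sum_eq_zero fun b _ => ?_
        have hb : (b : ℕ) ≠ i := by omega
        simp [hb]
      · refine Finset.sum_eq_zero fun b _ => ?_
        by_cases hb : (b : ℕ) = i
        · have hb' : (b : ℕ) ≠ j := fun h => h1 (Fin.ext (hb.symm.trans h))
          simp [hb']
        · simp [hb]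
    have hAA : Aᴴ * A = V * Matrix.diagonal (fun j : Fin N => ((d j : ℝ) : 𝕜)) * Vᴴ := by
      rw [hA, ← hsq]
      simp only [Matrix.conjTranspose_mul, Matrix.conjTranspose_conjTranspose]
      calc V * ((rectDiag 𝕜 M N s)ᴴ * Uᴴ) * (U * rectDiag 𝕜 M N s * Vᴴ)
          = V * ((rectDiag 𝕜 M N s)ᴴ * (Uᴴ * U) * rectDiag 𝕜 M N s) * Vᴴ := by
            simp only [Matrix.mul_assoc]
        _ = _ := by rw [hUU, Matrix.mul_one]
    have hpow : ∀ k : ℕ, (Aᴴ * A) ^ k =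
        V * Matrix.diagonal (fun j : Fin N => ((d j ^ k : ℝ) : 𝕜)) * Vᴴ := by
      intro k
      induction k with
      | zero => simp [hVV']
      | succ k ih =>
        rw [pow_succ, ih, hAA]
        calc V * Matrix.diagonal (fun j : Fin N => ((d j ^ k : ℝ) : 𝕜)) * Vᴴ *
              (V * Matrix.diagonal (fun j : Fin N => ((d j : ℝ) : 𝕜)) * Vᴴ)
            = V * (Matrix.diagonal (fun j : Fin N => ((d j ^ k : ℝ) : 𝕜)) * (Vᴴ * V) *
              Matrix.diagonal (fun j : Fin N => ((d j : ℝ) : 𝕜))) * Vᴴ := by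
              simp only [Matrix.mul_assoc]
          _ = _ := by
              rw [hVV, Matrix.mul_one, Matrix.diagonal_mul_diagonal]
              simp [pow_succ]
    have haev : ∀ r : Polynomial ℝ, Polynomial.aeval (Aᴴ * A) r =
        V * Matrix.diagonal (fun j : Fin N => ((r.eval (d j) : ℝ) : 𝕜)) * Vᴴ := by
      intro r
      induction r using Polynomial.induction_on' with
      | add r t hr ht =>
        rw [map_add, hr, ht, ← Matrix.add_mul, ← Matrix.mul_add, Matrix.diagonal_add]
        simp
      | monomial k a =>
        rw [Polynomial.aeval_monomial, hpow, ← Algebra.smul_def, ← Matrix.smul_mul,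
          ← Matrix.mul_smul, ← Matrix.diagonal_smul]
        congr 3
        ext j
        simp [RCLike.real_smul_eq_coe_mul]
    rw [haev]
    have hfin : rectDiag 𝕜 M N (fun j => f (s j)) =
        rectDiag 𝕜 M N s * Matrix.diagonal (fun j : Fin N => ((p.eval (d j) : ℝ) : 𝕜)) := by
      rw [hmul (fun j => p.eval (d j))]
      ext i j
      simp only [rectDiag, Matrix.of_apply]
      split_ifs with h
      · have hi : d i = s i ^ 2 := if_pos i.isLt
        rw [hi, hp i (lt_min i.isLt (h ▸ j.isLt))]
      · rfl
    rw [hfin]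
    conv_rhs => rw [hA]
    calc U * (rectDiag 𝕜 M N s * Matrix.diagonal fun j : Fin N => ((p.eval (d j) : ℝ) : 𝕜)) * Vᴴ
        = U * rectDiag 𝕜 M N s * (1 : Matrix (Fin N) (Fin N) 𝕜) *
            ((Matrix.diagonal fun j : Fin N => ((p.eval (d j) : ℝ) : 𝕜)) * Vᴴ) := by
          simp only [Matrix.mul_assoc, Matrix.one_mul]
      _ = _ := by
          rw [← hVV]
          simp only [Matrix.mul_assoc]
  let σ : ℕ → ℝ := fun j => matSingularValue A j
  have hσ : ∀ j, 0 ≤ σ j := fun j => LinearMap.singularValues_nonneg _ j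
  let Z : Finset ℝ := (Finset.range (min M N)).image s ∪ (Finset.range (min M N)).image σ
  have hZ : ∀ x ∈ Z, 0 ≤ x := by
    intro x hx
    rcases Finset.mem_union.mp hx with h | h <;> obtain ⟨j, -, rfl⟩ := Finset.mem_image.mp h
    exacts [hs j, hσ j]
  have hinj : Set.InjOn (fun x : ℝ => x ^ 2) (Z : Set ℝ) := fun x hx y hy h =>
    (sq_eq_sq₀ (hZ x hx) (hZ y hy)).mp h
  let p : Polynomial ℝ := Lagrange.interpolate Z (fun x => x ^ 2) (fun x => f x / x)
  have hp : ∀ x ∈ Z, x * p.eval (x ^ 2) = f x := by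
    intro x hx
    have h : p.eval (x ^ 2) = f x / x := Lagrange.eval_interpolate_at_node _ hinj hx
    rw [h]
    rcases eq_or_ne x 0 with rfl | h0
    · simp [hf]
    · field_simp
  have h := (exists_isSVD A).choose_spec.choose_spec
  rw [key p U V s hU hV (fun j hj => hp _ (Finset.mem_union_left _
    (Finset.mem_image_of_mem _ (Finset.mem_range.mpr hj)))) hA]
  exact key p _ _ σ h.left_unitary h.right_unitary (fun j hj => hp _ (Finset.mem_union_right _
    (Finset.mem_image_of_mem _ (Finset.mem_range.mpr hj)))) h.eq_mul

/-- The scalar function `s_{τ,q}(σ) = max (min (σ, τ), σ / q)`. -/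
noncomputable def sFun (τ q σ : ℝ) : ℝ := max (min σ τ) (σ / q)

/-- The operator `𝔅_{F,τ,q}(W) = 𝔖_{s_{τ,q}} (q F + P_{H^⊥} W)`, with `P_{H^⊥}` the orthogonal
projection onto the orthogonal complement of `H`. -/
noncomputable def bOp {𝕜 : Type*} [RCLike 𝕜] {M N : ℕ}
    (H : Submodule 𝕜 (Matrix (Fin M) (Fin N) 𝕜)) (F : Matrix (Fin M) (Fin N) 𝕜) (τ q : ℝ)
    (W : Matrix (Fin M) (Fin N) 𝕜) : Matrix (Fin M) (Fin N) 𝕜 :=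
  svCalculus (sFun τ q) ((q : 𝕜) • F + Hᗮ.starProjection W)

/-- `R_τ(A) = ∑_j (τ² - max(τ - σ_j(A), 0)²)`, the sum being over the `min M N` singular values. -/
noncomputable def rFun {𝕜 : Type*} [RCLike 𝕜] {M N : ℕ} (τ : ℝ)
    (A : Matrix (Fin M) (Fin N) 𝕜) : ℝ :=
  ∑ j ∈ Finset.range (min M N), (τ ^ 2 - (max (τ - matSingularValue A j) 0) ^ 2)

/-- The objective functional `R_τ(A) + q ‖A - F‖²` (Frobenius norm). -/
noncomputable def objective {𝕜 : Type*} [RCLike 𝕜] {M N : ℕ}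
    (F : Matrix (Fin M) (Fin N) 𝕜) (τ q : ℝ) (A : Matrix (Fin M) (Fin N) 𝕜) : ℝ :=
  rFun τ A + q * ‖A - F‖ ^ 2

/-! Put Φ = R_τ + ‖·‖². It is the sum of the convex function `phiFun` over the singular values, and
up to a constant the objective is Φ(A) + (q - 1)‖A‖² - 2q Re⟪F, A⟫, which is strongly convex. Write
T = 𝔖_s. The crux is `svCalculus_sFun_subgradient`: T(X) is half a subgradient of Φ at (X - T(X))/(q
- 1). It reduces to the scalar inequality `phiFun_sFun_subgradient`, since Φ(B) dominates the sum of
`phiFun` over the moduli of the diagonal of B in any pair of orthonormal bases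
(`sum_phiFun_rectEntry_le`).

If W is fixed, take X = qF + P_{H^⊥}W. Then T(X) = W and A = (X - W)/(q - 1) lies in H, so W is half
a subgradient at A. Testing against B - A with B in H sees only P_H W = qF - (q - 1)A, which is the
optimality condition. Strong convexity gives uniqueness, and A determines P_H W.

Monotonicity of subgradients makes T firmly nonexpansive, so 𝔅 is nonexpansive. It grows at rate 1/q
< 1 at infinity, hence has a fixed point. Firmness together with the energy lost by the projection
makes the orbits asymptotically regular, and compactness then gives convergence. -/

/-! ### Fixed points and orbits of nonexpansive maps. -/

section FixedPoint

variable {E : Type*} [NormedAddCommGroup E] [ProperSpace E]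

/-- A nonexpansive self-map of a proper normed space that contracts at infinity has a fixed
point. -/
theorem exists_isFixedPt_of_nonexpansive [NormedSpace ℝ E] {f : E → E}
    (hf : LipschitzWith 1 f) {r C : ℝ} (hr : r < 1) (hC : ∀ x, ‖f x‖ ≤ r * ‖x‖ + C) :
    ∃ x, Function.IsFixedPt f x := by
  -- Damping makes f a strict contraction, so Banach's theorem applies; the damping is removed in
  -- the limit.
  have hn : ∀ n : ℕ, ∃ x, (1 - 1 / ((n : ℝ) + 1)) • f x = x := by
    intro n
    have h0 : 0 ≤ 1 - 1 / ((n : ℝ) + 1) := by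
      rw [sub_nonneg, div_le_one (by positivity)]; linarith [n.cast_nonneg (α := ℝ)]
    have h1 : 1 - 1 / ((n : ℝ) + 1) < 1 := by
      have : 0 < 1 / ((n : ℝ) + 1) := by positivity
      linarith
    have hc : ContractingWith ⟨1 - 1 / ((n : ℝ) + 1), h0⟩
        (fun x => (1 - 1 / ((n : ℝ) + 1)) • f x) := by
      refine ⟨by exact_mod_cast h1, LipschitzWith.of_dist_le_mul fun x y => ?_⟩
      rw [dist_smul₀, Real.norm_of_nonneg h0]
      have := hf.dist_le_mul x y
      rw [NNReal.coe_one, one_mul] at this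
      exact mul_le_mul_of_nonneg_left this h0
    exact ⟨_, hc.fixedPoint_isFixedPt⟩
  choose x hx using hn
  have hC0 : 0 ≤ C := by simpa using (norm_nonneg _).trans (hC 0)
  -- From ‖x n‖ ≤ ‖f (x n)‖ ≤ r‖x n‖ + C.
  have hb : ∀ n, ‖x n‖ ≤ C / (1 - r) := by
    intro n
    have h0 : 0 ≤ 1 - 1 / ((n : ℝ) + 1) := by
      rw [sub_nonneg, div_le_one (by positivity)]; linarith [n.cast_nonneg (α := ℝ)]
    have h1 : 1 - 1 / ((n : ℝ) + 1) ≤ 1 := by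
      have : 0 < 1 / ((n : ℝ) + 1) := by positivity
      linarith
    have : ‖x n‖ ≤ ‖f (x n)‖ := by
      conv_lhs => rw [← hx n, norm_smul, Real.norm_of_nonneg h0]
      exact mul_le_of_le_one_left (norm_nonneg _) h1
    rw [le_div_iff₀ (by linarith)]
    linarith [hC (x n)]
  obtain ⟨a, -, φ, hφ, ha⟩ := (isCompact_closedBall (0 : E) (C / (1 - r))).tendsto_subseq
    (x := x) (fun n => by simpa using hb n)
  refine ⟨a, ?_⟩
  have ht : Tendsto (fun n : ℕ => (1 - 1 / ((n : ℝ) + 1))) atTop (𝓝 (1 - 0)) :=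
    tendsto_const_nhds.sub tendsto_one_div_add_atTop_nhds_zero_nat
  have h1 := (ht.comp hφ.tendsto_atTop).smul ((hf.continuous.tendsto a).comp ha)
  rw [sub_zero, one_smul] at h1
  refine tendsto_nhds_unique h1 (ha.congr fun n => ?_)
  exact (hx (φ n)).symm

/-- The iterates of an asymptotically regular nonexpansive map with a fixed point converge to a
fixed point. -/
theorem exists_tendsto_iterate_of_nonexpansive {f : E → E} (hf : LipschitzWith 1 f) {y : E}
    (hy : Function.IsFixedPt f y) (x : E)
    (hx : Tendsto (fun n : ℕ => f^[n] x - f^[n + 1] x) atTop (𝓝 0)) :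
    ∃ z, Function.IsFixedPt f z ∧ Tendsto (fun n : ℕ => f^[n] x) atTop (𝓝 z) := by
  have hanti : ∀ z, Function.IsFixedPt f z → Antitone fun n : ℕ => dist (f^[n] x) z := by
    intro z hz
    refine antitone_nat_of_succ_le fun n => ?_
    have := hf.dist_le_mul (f^[n] x) z
    rwa [NNReal.coe_one, one_mul, hz.eq, ← Function.iterate_succ_apply' f] at this
  obtain ⟨a, -, φ, hφ, ha⟩ := (isCompact_closedBall y (dist x y)).tendsto_subseq
    (x := fun n => f^[n] x) (fun n => hanti y hy (Nat.zero_le n))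
  -- Asymptotic regularity forces every cluster point of the orbit to be fixed. The distance to `a`
  -- is then antitone, so a small value along the subsequence controls the whole tail.
  have hfix : Function.IsFixedPt f a := by
    have h1 := ha.sub ((hf.continuous.tendsto a).comp ha)
    have h2 := hx.comp hφ.tendsto_atTop
    have h3 : a - f a = 0 := by
      refine tendsto_nhds_unique h1 (h2.congr fun n => ?_)
      simp only [Function.comp_apply, Function.iterate_succ_apply']
    exact (sub_eq_zero.mp h3).symm
  refine ⟨a, hfix, ?_⟩
  rw [Metric.tendsto_atTop]
  intro ε hε
  obtain ⟨k, hk⟩ := Metric.tendsto_atTop.mp ha ε hε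
  exact ⟨φ k, fun n hn => (hanti a hfix hn).trans_lt (hk k le_rfl)⟩

end FixedPoint

/-! ### Asymptotic regularity. -/

section FirmlyNonexpansive

variable {𝕜 E : Type*} [RCLike 𝕜] [NormedAddCommGroup E] [InnerProductSpace 𝕜 E]

/-- If `T` is firmly nonexpansive and `K` is a subspace, then the iterates of
`x ↦ T (c + P_{Kᗮ} x)` are asymptotically regular as soon as there is a fixed point. -/
theorem asymptoticRegular_of_firmlyNonexpansive (K : Submodule 𝕜 E) [K.HasOrthogonalProjection]
    {T : E → E}
    (hT : ∀ x y, ‖T x - T y‖ ^ 2 + ‖(x - T x) - (y - T y)‖ ^ 2 ≤ ‖x - y‖ ^ 2) (c : E) {y : E}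
    (hy : Function.IsFixedPt (fun x => T (c + Kᗮ.starProjection x)) y) (x : E) :
    Tendsto (fun n : ℕ => (fun x => T (c + Kᗮ.starProjection x))^[n] x -
      (fun x => T (c + Kᗮ.starProjection x))^[n + 1] x) atTop (𝓝 0) := by
  set f : E → E := fun x => T (c + Kᗮ.starProjection x) with hf
  set u : ℕ → E := fun n => f^[n] x with hu
  -- The difference of the residuals of `T` along the orbits of `x` and `y`, chosen so that u n - u
  -- (n + 1) = g n + P_K(u n - y). Both summands are controlled by the drop in ‖u n - y‖².
  let g : ℕ → E := fun n => ((c + Kᗮ.starProjection (u n)) - u (n + 1)) -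
    ((c + Kᗮ.starProjection y) - y)
  have hstep : ∀ n, ‖u (n + 1) - y‖ ^ 2 + (‖g n‖ ^ 2 + ‖K.starProjection (u n - y)‖ ^ 2) ≤
      ‖u n - y‖ ^ 2 := by
    intro n
    have h1 := hT (c + Kᗮ.starProjection (u n)) (c + Kᗮ.starProjection y)
    have h2 : T (c + Kᗮ.starProjection (u n)) = u (n + 1) := by
      simp only [hu, Function.iterate_succ_apply', hf]
    have h3 : T (c + Kᗮ.starProjection y) = y := hy
    rw [h2, h3, add_sub_add_left_eq_sub, ← map_sub] at h1
    have h4 := K.norm_sq_eq_add_norm_sq_starProjection (u n - y)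
    linarith
  have hsq : Tendsto (fun n => ‖g n‖ ^ 2 + ‖K.starProjection (u n - y)‖ ^ 2) atTop (𝓝 0) := by
    have hanti : Antitone fun n => ‖u n - y‖ ^ 2 :=
      antitone_nat_of_succ_le fun n => by
        have := hstep n
        have h1 : 0 ≤ ‖g n‖ ^ 2 + ‖K.starProjection (u n - y)‖ ^ 2 := by positivity
        linarith
    have hbd : BddBelow (Set.range fun n => ‖u n - y‖ ^ 2) :=
      ⟨0, by rintro _ ⟨n, rfl⟩; positivity⟩
    have hl := tendsto_atTop_ciInf hanti hbd
    have hl' := hl.sub (hl.comp (tendsto_add_atTop_nat 1))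
    rw [sub_self] at hl'
    refine squeeze_zero (fun n => by positivity) (fun n => ?_) hl'
    simp only [Function.comp_apply]
    linarith [hstep n]
  have haux : ∀ v : ℕ → E, (∀ n, ‖v n‖ ^ 2 ≤ ‖g n‖ ^ 2 + ‖K.starProjection (u n - y)‖ ^ 2) →
      Tendsto v atTop (𝓝 0) := by
    intro v hv
    rw [tendsto_zero_iff_norm_tendsto_zero]
    have h := (squeeze_zero (fun n => by positivity) hv hsq).sqrt
    simpa using h
  have hg := haux g fun n => by linarith [sq_nonneg ‖K.starProjection (u n - y)‖]
  have hp := haux (fun n => K.starProjection (u n - y)) fun n => by linarith [sq_nonneg ‖g n‖]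
  have hsum := hg.add hp
  rw [add_zero] at hsum
  refine hsum.congr fun n => ?_
  have h1 := K.starProjection_add_starProjection_orthogonal (u n)
  have h2 := K.starProjection_add_starProjection_orthogonal y
  change _ = u n - u (n + 1)
  simp only [g, map_sub]
  rw [eq_sub_of_add_eq h1, eq_sub_of_add_eq h2]
  abel

end FirmlyNonexpansive

/-! ### The scalar functions and their subgradients. -/

section Scalar

/-- The convex function `x ↦ τ² - max(τ - x, 0)² + x²`. -/
noncomputable def phiFun (τ x : ℝ) : ℝ := τ ^ 2 - (max (τ - x) 0) ^ 2 + x ^ 2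

variable {τ q : ℝ}

theorem phiFun_of_le {x : ℝ} (h : x ≤ τ) : phiFun τ x = 2 * τ * x := by
  rw [phiFun, max_eq_left (by linarith)]; ring

theorem phiFun_of_ge {x : ℝ} (h : τ ≤ x) : phiFun τ x = τ ^ 2 + x ^ 2 := by
  rw [phiFun, max_eq_right (by linarith)]; ring

theorem two_mul_le_phiFun (x : ℝ) : 2 * τ * x ≤ phiFun τ x := by
  rcases le_total x τ with h | h
  · rw [phiFun_of_le h]
  · rw [phiFun_of_ge h]; nlinarith [sq_nonneg (x - τ)]

theorem le_phiFun_of_ge {a : ℝ} (ha : τ ≤ a) (b : ℝ) :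
    τ ^ 2 + a ^ 2 + 2 * a * (b - a) ≤ phiFun τ b := by
  rcases le_total b τ with h | h
  · rw [phiFun_of_le h]
    nlinarith [mul_nonneg (sub_nonneg.mpr ha) (sub_nonneg.mpr h), sq_nonneg (a - τ)]
  · rw [phiFun_of_ge h]; nlinarith [sq_nonneg (a - b)]

/-- The two branches meet with equal slope at τ, so the derivative at a is 2 max(τ, a) on the whole
line. -/
theorem phiFun_subgradient (a b : ℝ) :
    phiFun τ a + 2 * max τ a * (b - a) ≤ phiFun τ b := by
  rcases le_total a τ with h | h
  · rw [phiFun_of_le h, max_eq_left h]; linarith [two_mul_le_phiFun (τ := τ) b]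
  · rw [phiFun_of_ge h, max_eq_right h]; exact le_phiFun_of_ge h b

theorem phiFun_zero (hτ : 0 ≤ τ) : phiFun τ 0 = 0 := by
  rw [phiFun_of_le hτ]; ring

theorem phiFun_nonneg (hτ : 0 ≤ τ) {x : ℝ} (hx : 0 ≤ x) : 0 ≤ phiFun τ x :=
  le_trans (by positivity) (two_mul_le_phiFun x)

theorem phiFun_mono (hτ : 0 ≤ τ) {x y : ℝ} (h : x ≤ y) : phiFun τ x ≤ phiFun τ y := by
  have := phiFun_subgradient (τ := τ) x y
  have h1 : 0 ≤ 2 * max τ x * (y - x) :=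
    mul_nonneg (by linarith [le_max_left τ x]) (by linarith)
  linarith

/-- Jensen's inequality for subconvex combinations. -/
theorem phiFun_sum_le {ι : Type*} (s : Finset ι) (hτ : 0 ≤ τ) {c β : ι → ℝ}
    (hc : ∀ i ∈ s, 0 ≤ c i) (hc1 : ∑ i ∈ s, c i ≤ 1) :
    phiFun τ (∑ i ∈ s, c i * β i) ≤ ∑ i ∈ s, c i * phiFun τ (β i) := by
  set a := ∑ i ∈ s, c i * β i with ha
  -- The tangent at `a` is nonpositive at 0; this absorbs the weight missing from a total below one.
  have h0 := phiFun_subgradient (τ := τ) a 0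
  rw [phiFun_zero hτ] at h0
  have h1 : ∑ i ∈ s, c i * (phiFun τ a + 2 * max τ a * (β i - a)) ≤
      ∑ i ∈ s, c i * phiFun τ (β i) :=
    Finset.sum_le_sum fun i hi => mul_le_mul_of_nonneg_left (phiFun_subgradient a (β i)) (hc i hi)
  have h2 : ∀ m z x : ℝ, ∑ i ∈ s, c i * (m + z * (β i - x)) =
      (∑ i ∈ s, c i) * (m - z * x) + z * ∑ i ∈ s, c i * β i := by
    intro m z x
    rw [Finset.sum_mul, Finset.mul_sum, ← Finset.sum_add_distrib]
    exact Finset.sum_congr rfl fun i _ => by ring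
  rw [h2, ← ha] at h1
  nlinarith

theorem sFun_zero (hτ : 0 ≤ τ) : sFun τ q 0 = 0 := by
  simp [sFun, hτ]

theorem sFun_nonneg (hτ : 0 ≤ τ) {w : ℝ} (hw : 0 ≤ w) : 0 ≤ sFun τ q w :=
  le_max_of_le_left (le_min hw hτ)

theorem sFun_le_self (hq : 1 < q) {w : ℝ} (hw : 0 ≤ w) : sFun τ q w ≤ w :=
  max_le (min_le_left _ _) (div_le_self hw hq.le)

theorem sFun_sub_mem (hτ : 0 ≤ τ) (hq : 1 < q) {w : ℝ} (hw : 0 ≤ w) :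
    0 ≤ sFun τ q w - w / q ∧ sFun τ q w - w / q ≤ τ := by
  have h1 : 0 ≤ w / q := by positivity
  refine ⟨sub_nonneg.mpr (le_max_right _ _), ?_⟩
  rw [sub_le_iff_le_add]
  exact max_le ((min_le_right _ _).trans (by linarith)) (by linarith)

/-- `s(w)` is half a subgradient of `phiFun` at `(w - s(w)) / (q - 1)`. -/
theorem phiFun_sFun_subgradient (hτ : 0 ≤ τ) (hq : 1 < q) {w : ℝ} (hw : 0 ≤ w) (b : ℝ) :
    phiFun τ ((q - 1)⁻¹ * (w - sFun τ q w)) +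
      2 * sFun τ q w * (b - (q - 1)⁻¹ * (w - sFun τ q w)) ≤ phiFun τ |b| := by
  have hq1 : 0 < q - 1 := by linarith
  have hq0 : 0 < q := by linarith
  have hbb := two_mul_le_phiFun (τ := τ) |b|
  rcases le_total w τ with h1 | h1
  -- Here the base point is 0, the kink of b ↦ φ(|b|), whose half-subdifferential [-τ, τ] contains
  -- w. In the next case the base point lies on the linear branch, and in the last on the quadratic
  -- one.
  · have hs : sFun τ q w = w := by
      rw [sFun, min_eq_left h1, max_eq_left (div_le_self hw hq.le)]
    rw [hs, sub_self, mul_zero, phiFun_zero hτ]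
    nlinarith [le_abs_self b, abs_nonneg b]
  rcases le_total w (q * τ) with h2 | h2
  · have hs : sFun τ q w = τ := by
      rw [sFun, min_eq_right h1, max_eq_left]
      rw [div_le_iff₀ hq0]; linarith
    rw [hs, phiFun_of_le]
    · nlinarith [le_abs_self b]
    · rw [inv_mul_le_iff₀ hq1]; linarith
  · have hle : τ ≤ w / q := by rw [le_div_iff₀ hq0]; linarith
    have hs : sFun τ q w = w / q := by
      rw [sFun, min_eq_right h1, max_eq_right hle]
    have ha : (q - 1)⁻¹ * (w - w / q) = w / q := by
      field_simp
    rw [hs, ha, phiFun_of_ge hle]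
    have := le_phiFun_of_ge hle |b|
    have h3 : 0 ≤ w / q := by positivity
    nlinarith [le_abs_self b]

end Scalar

/-! ### Majorization of diagonals by singular values. -/

section Decomposition

variable {𝕜 : Type*} [RCLike 𝕜] {M N : ℕ}

/-- The `j`-th diagonal entry of a rectangular matrix. -/
def rectEntry (A : Matrix (Fin M) (Fin N) 𝕜) (j : Fin (min M N)) : 𝕜 :=
  A (Fin.castLE (min_le_left M N) j) (Fin.castLE (min_le_right M N) j)

theorem sum_rectDiag (s : ℕ → ℝ) (g : Fin M → Fin N → 𝕜) :
    ∑ i, ∑ j, g i j * rectDiag 𝕜 M N s i j =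
      ∑ k : Fin (min M N), g (Fin.castLE (min_le_left M N) k) (Fin.castLE (min_le_right M N) k) *
        ((s k : ℝ) : 𝕜) := by
  rw [← Finset.sum_product']
  symm
  refine Finset.sum_of_injOn (fun k => (Fin.castLE (min_le_left M N) k,
    Fin.castLE (min_le_right M N) k)) ?_ (fun _ _ => by simp) ?_ ?_
  · intro a _ b _ h
    exact Fin.castLE_injective (min_le_left M N) (Prod.ext_iff.mp h).1
  · rintro ⟨i, j⟩ - h
    have hij : (i : ℕ) ≠ j := fun hij => h ⟨⟨i, lt_min i.isLt (hij ▸ j.isLt)⟩, by simp, by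
      simp [Prod.ext_iff, Fin.ext_iff, hij]⟩
    simp [rectDiag, hij]
  · intro k _
    simp [rectDiag]

theorem re_inner_rectDiag (U : Matrix (Fin M) (Fin M) 𝕜) (V : Matrix (Fin N) (Fin N) 𝕜)
    (s : ℕ → ℝ) (B : Matrix (Fin M) (Fin N) 𝕜) :
    RCLike.re (inner 𝕜 (U * rectDiag 𝕜 M N s * Vᴴ) B) =
      ∑ j : Fin (min M N), s j * RCLike.re (rectEntry (Uᴴ * B * V) j) := by
  have h1 : inner 𝕜 (U * rectDiag 𝕜 M N s * Vᴴ) B =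
      ((rectDiag 𝕜 M N s)ᴴ * (Uᴴ * B * V)).trace := by
    change ((U * rectDiag 𝕜 M N s * Vᴴ)ᴴ * B).trace = _
    rw [Matrix.conjTranspose_mul, Matrix.conjTranspose_mul, Matrix.conjTranspose_conjTranspose,
      Matrix.mul_assoc, Matrix.trace_mul_comm V]
    simp only [Matrix.mul_assoc]
  have h2 : ((rectDiag 𝕜 M N s)ᴴ * (Uᴴ * B * V)).trace =
      ∑ i, ∑ j, (Uᴴ * B * V) i j * rectDiag 𝕜 M N s i j := by
    rw [Finset.sum_comm]
    simp only [Matrix.trace, Matrix.diag_apply]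
    refine Finset.sum_congr rfl fun j _ => ?_
    rw [Matrix.mul_apply]
    refine Finset.sum_congr rfl fun i _ => ?_
    rw [mul_comm, Matrix.conjTranspose_apply]
    congr 1
    simp only [rectDiag, Matrix.of_apply]
    split_ifs <;> simp
  rw [h1, h2, sum_rectDiag s (fun i j => (Uᴴ * B * V) i j), map_sum]
  refine Finset.sum_congr rfl fun j _ => ?_
  rw [mul_comm, RCLike.re_ofReal_mul]
  rfl

theorem conjTranspose_mul_rectDiag_mul {U : Matrix (Fin M) (Fin M) 𝕜}
    {V : Matrix (Fin N) (Fin N) 𝕜} (hU : U ∈ Matrix.unitaryGroup (Fin M) 𝕜)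
    (hV : V ∈ Matrix.unitaryGroup (Fin N) 𝕜) (s : ℕ → ℝ) :
    Uᴴ * (U * rectDiag 𝕜 M N s * Vᴴ) * V = rectDiag 𝕜 M N s := by
  have hUU : Uᴴ * U = 1 := Matrix.mem_unitaryGroup_iff'.mp hU
  have hVV : Vᴴ * V = 1 := Matrix.mem_unitaryGroup_iff'.mp hV
  rw [Matrix.mul_assoc, Matrix.mul_assoc, hVV, Matrix.mul_one, ← Matrix.mul_assoc, hUU,
    Matrix.one_mul]

theorem rectEntry_rectDiag (s : ℕ → ℝ) (j : Fin (min M N)) :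
    rectEntry (rectDiag 𝕜 M N s) j = ((s j : ℝ) : 𝕜) := by
  simp [rectEntry, rectDiag]

theorem norm_sq_rectDiag {U : Matrix (Fin M) (Fin M) 𝕜} {V : Matrix (Fin N) (Fin N) 𝕜}
    (hU : U ∈ Matrix.unitaryGroup (Fin M) 𝕜) (hV : V ∈ Matrix.unitaryGroup (Fin N) 𝕜)
    (s : ℕ → ℝ) :
    ‖U * rectDiag 𝕜 M N s * Vᴴ‖ ^ 2 = ∑ j : Fin (min M N), s j ^ 2 := by
  rw [← inner_self_eq_norm_sq (𝕜 := 𝕜), re_inner_rectDiag, conjTranspose_mul_rectDiag_mul hU hV]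
  refine Finset.sum_congr rfl fun j _ => ?_
  rw [rectEntry_rectDiag, RCLike.ofReal_re, sq]

theorem rectDiag_sub_smul (s t : ℕ → ℝ) (r : ℝ) :
    rectDiag 𝕜 M N (fun j => r * (s j - t j)) =
      (r : 𝕜) • (rectDiag 𝕜 M N s - rectDiag 𝕜 M N t) := by
  ext i j
  simp only [rectDiag, Matrix.of_apply, Matrix.smul_apply, Matrix.sub_apply]
  split_ifs <;> simp

/-- Half the sum of the squared moduli of the entries of two matrices, taken over the common
index range. -/
noncomputable def pairWeight (P : Matrix (Fin M) (Fin M) 𝕜) (R : Matrix (Fin N) (Fin N) 𝕜)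
    (j k : Fin (min M N)) : ℝ :=
  (‖P (Fin.castLE (min_le_left M N) j) (Fin.castLE (min_le_left M N) k)‖ ^ 2 +
    ‖R (Fin.castLE (min_le_right M N) j) (Fin.castLE (min_le_right M N) k)‖ ^ 2) / 2

/-- Rows of a unitary matrix are unit vectors; truncating to m columns leaves only an inequality, so
the weights are doubly substochastic rather than doubly stochastic. -/
theorem sum_norm_sq_row_le {n m : ℕ} {P : Matrix (Fin n) (Fin n) 𝕜}
    (hP : P ∈ Matrix.unitaryGroup (Fin n) 𝕜) (h : m ≤ n) (i : Fin n) :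
    ∑ k : Fin m, ‖P i (Fin.castLE h k)‖ ^ 2 ≤ 1 := by
  have h1 : ∑ k, ‖P i k‖ ^ 2 = 1 := by
    have := congrFun₂ (Matrix.mem_unitaryGroup_iff.mp hP) i i
    simp only [Matrix.mul_apply, Matrix.star_apply, RCLike.star_def, RCLike.mul_conj,
      Matrix.one_apply_eq] at this
    exact_mod_cast this
  rw [← h1, ← Finset.sum_image (f := fun k => ‖P i k‖ ^ 2) (s := Finset.univ)
    (g := Fin.castLE h) (fun a _ b _ hab => Fin.castLE_injective h hab)]
  exact Finset.sum_le_sum_of_subset_of_nonneg (Finset.subset_univ _) fun _ _ _ => by positivity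

theorem pairWeight_row_sum_le {P : Matrix (Fin M) (Fin M) 𝕜} {R : Matrix (Fin N) (Fin N) 𝕜}
    (hP : P ∈ Matrix.unitaryGroup (Fin M) 𝕜) (hR : R ∈ Matrix.unitaryGroup (Fin N) 𝕜)
    (j : Fin (min M N)) : ∑ k, pairWeight P R j k ≤ 1 := by
  have h1 := sum_norm_sq_row_le hP (min_le_left M N) (Fin.castLE (min_le_left M N) j)
  have h2 := sum_norm_sq_row_le hR (min_le_right M N) (Fin.castLE (min_le_right M N) j)
  simp only [pairWeight]
  rw [← Finset.sum_div, Finset.sum_add_distrib]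
  linarith

theorem pairWeight_col_sum_le {P : Matrix (Fin M) (Fin M) 𝕜} {R : Matrix (Fin N) (Fin N) 𝕜}
    (hP : P ∈ Matrix.unitaryGroup (Fin M) 𝕜) (hR : R ∈ Matrix.unitaryGroup (Fin N) 𝕜)
    (k : Fin (min M N)) : ∑ j, pairWeight P R j k ≤ 1 := by
  have h := pairWeight_row_sum_le (P := Pᴴ) (R := Rᴴ) (Unitary.star_mem hP) (Unitary.star_mem hR) k
  refine le_trans (le_of_eq (Finset.sum_congr rfl fun j _ => ?_)) h
  simp [pairWeight]

/-- The entry is a sum of terms P_jk · conj(R_jk) · β_k, and 2|P_jk||R_jk| ≤ |P_jk|² + |R_jk|². -/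
theorem norm_rectEntry_le (P : Matrix (Fin M) (Fin M) 𝕜) (R : Matrix (Fin N) (Fin N) 𝕜)
    {β : ℕ → ℝ} (hβ : ∀ j, 0 ≤ β j) (j : Fin (min M N)) :
    ‖rectEntry (P * rectDiag 𝕜 M N β * Rᴴ) j‖ ≤ ∑ k : Fin (min M N), pairWeight P R j k * β k := by
  have h1 : rectEntry (P * rectDiag 𝕜 M N β * Rᴴ) j = ∑ k : Fin (min M N),
      (P (Fin.castLE (min_le_left M N) j) (Fin.castLE (min_le_left M N) k) *
        star (R (Fin.castLE (min_le_right M N) j) (Fin.castLE (min_le_right M N) k))) *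
        ((β k : ℝ) : 𝕜) := by
    rw [← sum_rectDiag β fun i l => P (Fin.castLE (min_le_left M N) j) i *
      star (R (Fin.castLE (min_le_right M N) j) l), Finset.sum_comm]
    simp only [rectEntry, Matrix.mul_apply, Matrix.conjTranspose_apply, Finset.sum_mul]
    exact Finset.sum_congr rfl fun _ _ => Finset.sum_congr rfl fun _ _ => by ring
  rw [h1]
  refine (norm_sum_le _ _).trans (Finset.sum_le_sum fun k _ => ?_)
  rw [norm_mul, norm_mul, norm_star, RCLike.norm_ofReal, abs_of_nonneg (hβ k)]
  refine mul_le_mul_of_nonneg_right ?_ (hβ k)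
  rw [pairWeight]
  linarith [two_mul_le_add_sq ‖P (Fin.castLE (min_le_left M N) j) (Fin.castLE (min_le_left M N) k)‖
    ‖R (Fin.castLE (min_le_right M N) j) (Fin.castLE (min_le_right M N) k)‖]

/-- The diagonal of a matrix in any pair of orthonormal bases is majorized by its singular values,
tested on `phiFun`. -/
theorem sum_phiFun_rectEntry_le {τ : ℝ} (hτ : 0 ≤ τ) {U X : Matrix (Fin M) (Fin M) 𝕜}
    {V Y : Matrix (Fin N) (Fin N) 𝕜} (hU : U ∈ Matrix.unitaryGroup (Fin M) 𝕜)
    (hV : V ∈ Matrix.unitaryGroup (Fin N) 𝕜) (hX : X ∈ Matrix.unitaryGroup (Fin M) 𝕜)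
    (hY : Y ∈ Matrix.unitaryGroup (Fin N) 𝕜) {β : ℕ → ℝ} (hβ : ∀ j, 0 ≤ β j) :
    ∑ j, phiFun τ ‖rectEntry (Uᴴ * (X * rectDiag 𝕜 M N β * Yᴴ) * V) j‖ ≤
      ∑ j : Fin (min M N), phiFun τ (β j) := by
  have hP : Uᴴ * X ∈ Matrix.unitaryGroup (Fin M) 𝕜 := mul_mem (Unitary.star_mem hU) hX
  have hR : Vᴴ * Y ∈ Matrix.unitaryGroup (Fin N) 𝕜 := mul_mem (Unitary.star_mem hV) hY
  have hw : ∀ j k, 0 ≤ pairWeight (Uᴴ * X) (Vᴴ * Y) j k := fun j k => by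
    unfold pairWeight; positivity
  have he : Uᴴ * (X * rectDiag 𝕜 M N β * Yᴴ) * V =
      (Uᴴ * X) * rectDiag 𝕜 M N β * (Vᴴ * Y)ᴴ := by
    simp only [Matrix.conjTranspose_mul, Matrix.conjTranspose_conjTranspose, Matrix.mul_assoc]
  rw [he]
  -- Row sums at most one permit Jensen; after exchanging the sums, column sums at most one remove
  -- the weights.
  calc _ ≤ ∑ j, ∑ k, pairWeight (Uᴴ * X) (Vᴴ * Y) j k * phiFun τ (β k) := by
        refine Finset.sum_le_sum fun j _ => ?_
        exact (phiFun_mono hτ (norm_rectEntry_le _ _ hβ j)).trans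
          (phiFun_sum_le _ hτ (fun k _ => hw j k) (pairWeight_row_sum_le hP hR j))
    _ = ∑ k, (∑ j, pairWeight (Uᴴ * X) (Vᴴ * Y) j k) * phiFun τ (β k) := by
        rw [Finset.sum_comm]
        simp only [Finset.sum_mul]
    _ ≤ _ := Finset.sum_le_sum fun k _ =>
        mul_le_of_le_one_left (phiFun_nonneg hτ (hβ k)) (pairWeight_col_sum_le hP hR k)

theorem matSingularValue_nonneg (A : Matrix (Fin M) (Fin N) 𝕜) (j : ℕ) :
    0 ≤ matSingularValue A j :=
  LinearMap.singularValues_nonneg _ j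

/-- `R_τ(A) + ‖A‖²` is the sum of `phiFun` over the singular values. -/
theorem rFun_add_norm_sq (τ : ℝ) (A : Matrix (Fin M) (Fin N) 𝕜) :
    rFun τ A + ‖A‖ ^ 2 = ∑ j : Fin (min M N), phiFun τ (matSingularValue A j) := by
  obtain ⟨U, V, h⟩ := exists_isSVD A
  have hn : ‖A‖ ^ 2 = ∑ j : Fin (min M N), matSingularValue A j ^ 2 := by
    rw [← norm_sq_rectDiag h.left_unitary h.right_unitary, ← h.eq_mul]
  rw [hn, rFun, Finset.sum_range, ← Finset.sum_add_distrib]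
  rfl

end Decomposition

/-! ### The operators 𝔖_s and 𝔅, and the minimizer. -/

section Operator

variable {𝕜 : Type*} [RCLike 𝕜] {M N : ℕ} {τ q : ℝ}

theorem svCalculus_sFun_eq (hτ : 0 ≤ τ) {W : Matrix (Fin M) (Fin N) 𝕜}
    {U : Matrix (Fin M) (Fin M) 𝕜} {V : Matrix (Fin N) (Fin N) 𝕜} (h : IsSVD W U V) :
    svCalculus (sFun τ q) W =
      U * rectDiag 𝕜 M N (fun j => sFun τ q (matSingularValue W j)) * Vᴴ :=
  svCalculus_eq (sFun_zero hτ) h.left_unitary h.right_unitary (matSingularValue_nonneg W) h.eq_mul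

theorem smul_sub_svd (r : ℝ) (U : Matrix (Fin M) (Fin M) 𝕜) (V : Matrix (Fin N) (Fin N) 𝕜)
    (s t : ℕ → ℝ) :
    (r : 𝕜) • (U * rectDiag 𝕜 M N s * Vᴴ - U * rectDiag 𝕜 M N t * Vᴴ) =
      U * rectDiag 𝕜 M N (fun j => r * (s j - t j)) * Vᴴ := by
  rw [rectDiag_sub_smul]
  simp only [Matrix.mul_smul, Matrix.smul_mul, Matrix.mul_sub, Matrix.sub_mul]

/-- `𝔖_s(W)` is half a subgradient of `R_τ + ‖·‖²` at `(q - 1)⁻¹ (W - 𝔖_s(W))`. -/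
theorem svCalculus_sFun_subgradient (hτ : 0 ≤ τ) (hq : 1 < q) {W A : Matrix (Fin M) (Fin N) 𝕜}
    (hA : A = (((q - 1)⁻¹ : ℝ) : 𝕜) • (W - svCalculus (sFun τ q) W))
    (B : Matrix (Fin M) (Fin N) 𝕜) :
    rFun τ A + ‖A‖ ^ 2 + 2 * RCLike.re (inner 𝕜 (svCalculus (sFun τ q) W) (B - A)) ≤
      rFun τ B + ‖B‖ ^ 2 := by
  obtain ⟨U, V, hW⟩ := exists_isSVD W
  obtain ⟨X, Y, hB⟩ := exists_isSVD B
  obtain ⟨X', Y', hA'⟩ := exists_isSVD A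
  set w : ℕ → ℝ := matSingularValue W
  have hw : ∀ j, 0 ≤ w j := matSingularValue_nonneg W
  set a : ℕ → ℝ := fun j => (q - 1)⁻¹ * (w j - sFun τ q (w j)) with ha
  have ha0 : ∀ j, 0 ≤ a j := fun j => mul_nonneg (inv_nonneg.mpr (by linarith))
    (sub_nonneg.mpr (sFun_le_self hq (hw j)))
  have hAsvd : A = U * rectDiag 𝕜 M N a * Vᴴ := by
    rw [hA, svCalculus_sFun_eq hτ hW, ha, ← smul_sub_svd]
    congr 2
    exact hW.eq_mul
  -- the value at `A`
  have h1 : rFun τ A + ‖A‖ ^ 2 ≤ ∑ j : Fin (min M N), phiFun τ (a j) := by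
    have h := sum_phiFun_rectEntry_le hτ hA'.left_unitary hA'.right_unitary hW.left_unitary
      hW.right_unitary ha0
    rw [← hAsvd] at h
    rw [rFun_add_norm_sq]
    refine le_trans (le_of_eq (Finset.sum_congr rfl fun j _ => ?_)) h
    have h2 : X'ᴴ * A * Y' = rectDiag 𝕜 M N (matSingularValue A) := by
      conv_lhs => rw [hA'.eq_mul]
      exact conjTranspose_mul_rectDiag_mul hA'.left_unitary hA'.right_unitary _
    rw [h2, rectEntry_rectDiag, RCLike.norm_ofReal, abs_of_nonneg (matSingularValue_nonneg A j)]
  -- the value at `B`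
  have h2 : ∑ j, phiFun τ ‖rectEntry (Uᴴ * B * V) j‖ ≤ rFun τ B + ‖B‖ ^ 2 := by
    have h := sum_phiFun_rectEntry_le hτ hW.left_unitary hW.right_unitary hB.left_unitary
      hB.right_unitary (matSingularValue_nonneg B)
    rwa [← hB.eq_mul, ← rFun_add_norm_sq] at h
  have h3 : RCLike.re (inner 𝕜 (svCalculus (sFun τ q) W) (B - A)) =
      ∑ j : Fin (min M N), sFun τ q (w j) * (RCLike.re (rectEntry (Uᴴ * B * V) j) - a j) := by
    rw [svCalculus_sFun_eq hτ hW, inner_sub_right, map_sub, re_inner_rectDiag, re_inner_rectDiag,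
      hAsvd, conjTranspose_mul_rectDiag_mul hW.left_unitary hW.right_unitary,
      ← Finset.sum_sub_distrib]
    refine Finset.sum_congr rfl fun j _ => ?_
    rw [rectEntry_rectDiag, RCLike.ofReal_re, mul_sub]
  have h4 : ∀ j : Fin (min M N), phiFun τ (a j) +
      2 * (sFun τ q (w j) * (RCLike.re (rectEntry (Uᴴ * B * V) j) - a j)) ≤
      phiFun τ ‖rectEntry (Uᴴ * B * V) j‖ := fun j => by
    have h := phiFun_sFun_subgradient hτ hq (hw j) (RCLike.re (rectEntry (Uᴴ * B * V) j))
    rw [mul_assoc] at h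
    exact h.trans (phiFun_mono hτ (RCLike.abs_re_le_norm _))
  have h5 := Finset.sum_le_sum fun j (_ : j ∈ Finset.univ) => h4 j
  rw [Finset.sum_add_distrib, ← Finset.mul_sum, ← h3] at h5
  linarith

/-- The operator `𝔖_s` is firmly nonexpansive. -/
theorem svCalculus_sFun_firmlyNonexpansive (hτ : 0 ≤ τ) (hq : 1 < q)
    (W W' : Matrix (Fin M) (Fin N) 𝕜) :
    ‖svCalculus (sFun τ q) W - svCalculus (sFun τ q) W'‖ ^ 2 +
      ‖(W - svCalculus (sFun τ q) W) - (W' - svCalculus (sFun τ q) W')‖ ^ 2 ≤ ‖W - W'‖ ^ 2 := by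
  set Z := svCalculus (sFun τ q) W
  set Z' := svCalculus (sFun τ q) W'
  -- Each point is tested against the other. Adding the two inequalities cancels the values of Φ and
  -- leaves monotonicity, the sign of the cross term in ‖W - W'‖².
  have h1 := svCalculus_sFun_subgradient hτ hq (W := W) rfl
    ((((q - 1)⁻¹ : ℝ) : 𝕜) • (W' - Z'))
  have h2 := svCalculus_sFun_subgradient hτ hq (W := W') rfl
    ((((q - 1)⁻¹ : ℝ) : 𝕜) • (W - Z))
  rw [← smul_sub, inner_smul_right, RCLike.re_ofReal_mul] at h1 h2
  have h3 : (q - 1)⁻¹ * (RCLike.re (inner 𝕜 Z ((W' - Z') - (W - Z))) +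
      RCLike.re (inner 𝕜 Z' ((W - Z) - (W' - Z')))) ≤ 0 := by
    linarith
  have h4 : RCLike.re (inner 𝕜 Z ((W' - Z') - (W - Z))) +
      RCLike.re (inner 𝕜 Z' ((W - Z) - (W' - Z'))) =
      -RCLike.re (inner 𝕜 (Z - Z') ((W - Z) - (W' - Z'))) := by
    rw [← neg_sub (W - Z), inner_neg_right, inner_sub_left, map_neg, map_sub]
    ring
  have h5 : 0 ≤ RCLike.re (inner 𝕜 (Z - Z') ((W - Z) - (W' - Z'))) := by
    rw [h4] at h3
    have : 0 < (q - 1)⁻¹ := inv_pos.mpr (by linarith)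
    by_contra! hneg
    nlinarith
  have h6 : W - W' = (Z - Z') + ((W - Z) - (W' - Z')) := by abel
  rw [h6, norm_add_sq (𝕜 := 𝕜)]
  linarith

/-- Since 0 ≤ s(w) - w/q ≤ τ, the operator stays within bounded distance of W/q. This supplies the
contraction at infinity. -/
theorem norm_svCalculus_sFun_le (hτ : 0 ≤ τ) (hq : 1 < q) (W : Matrix (Fin M) (Fin N) 𝕜) :
    ‖svCalculus (sFun τ q) W‖ ≤ ‖W‖ / q + Real.sqrt ((min M N : ℕ) * τ ^ 2) := by
  obtain ⟨U, V, hW⟩ := exists_isSVD W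
  have hq0 : 0 < q := by linarith
  -- The factor 1 and the subtracted 0 give the shape that `smul_sub_svd` needs, applied twice.
  have h1 : svCalculus (sFun τ q) W - ((q⁻¹ : ℝ) : 𝕜) • W = U * rectDiag 𝕜 M N
      (fun j => 1 * (sFun τ q (matSingularValue W j) - q⁻¹ * (matSingularValue W j - 0))) * Vᴴ := by
    rw [← smul_sub_svd, ← smul_sub_svd, svCalculus_sFun_eq hτ hW]
    have h0 : rectDiag 𝕜 M N (fun _ => 0) = 0 := by
      ext i j; simp [rectDiag]
    rw [h0, Matrix.mul_zero, Matrix.zero_mul, sub_zero, RCLike.ofReal_one, one_smul]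
    conv_lhs => enter [2, 2]; rw [hW.eq_mul]
  have h2 : ‖svCalculus (sFun τ q) W - ((q⁻¹ : ℝ) : 𝕜) • W‖ ≤
      Real.sqrt ((min M N : ℕ) * τ ^ 2) := by
    refine Real.le_sqrt_of_sq_le ?_
    rw [h1, norm_sq_rectDiag hW.left_unitary hW.right_unitary]
    refine (Finset.sum_le_card_nsmul _ _ (τ ^ 2) fun j _ => ?_).trans (by simp)
    have := sFun_sub_mem hτ hq (matSingularValue_nonneg W j)
    rw [one_mul, sub_zero, inv_mul_eq_div]
    exact pow_le_pow_left₀ this.1 this.2 2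
  have h3 : ‖((q⁻¹ : ℝ) : 𝕜) • W‖ = ‖W‖ / q := by
    rw [norm_smul, RCLike.norm_ofReal, abs_of_pos (inv_pos.mpr hq0), inv_mul_eq_div]
  calc _ = ‖((q⁻¹ : ℝ) : 𝕜) • W + (svCalculus (sFun τ q) W - ((q⁻¹ : ℝ) : 𝕜) • W)‖ := by
        rw [add_sub_cancel]
    _ ≤ _ := (norm_add_le _ _).trans (by rw [h3]; linarith)

variable {H : Submodule 𝕜 (Matrix (Fin M) (Fin N) 𝕜)} {F : Matrix (Fin M) (Fin N) 𝕜}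

theorem lipschitzWith_bOp (hτ : 0 ≤ τ) (hq : 1 < q) : LipschitzWith 1 (bOp H F τ q) := by
  refine LipschitzWith.of_dist_le_mul fun W W' => ?_
  rw [NNReal.coe_one, one_mul, dist_eq_norm, dist_eq_norm]
  have h1 := svCalculus_sFun_firmlyNonexpansive hτ hq ((q : 𝕜) • F + Hᗮ.starProjection W)
    ((q : 𝕜) • F + Hᗮ.starProjection W')
  rw [add_sub_add_left_eq_sub, ← map_sub] at h1
  have h2 := abs_le_of_sq_le_sq (a := ‖bOp H F τ q W - bOp H F τ q W'‖)
    (b := ‖Hᗮ.starProjection (W - W')‖)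
    ((le_add_of_nonneg_right (sq_nonneg _)).trans h1) (norm_nonneg _)
  exact (le_abs_self _).trans (h2.trans (Hᗮ.norm_starProjection_apply_le _))

theorem exists_isFixedPt_bOp (hτ : 0 ≤ τ) (hq : 1 < q) :
    ∃ W, Function.IsFixedPt (bOp H F τ q) W := by
  have : ProperSpace (Matrix (Fin M) (Fin N) 𝕜) := FiniteDimensional.proper_rclike 𝕜 _
  refine exists_isFixedPt_of_nonexpansive (lipschitzWith_bOp hτ hq) (r := 1 / q)
    (C := ‖(q : 𝕜) • F‖ / q + Real.sqrt ((min M N : ℕ) * τ ^ 2))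
    ((div_lt_one (by linarith)).mpr hq) fun W => ?_
  have h1 := norm_svCalculus_sFun_le hτ hq ((q : 𝕜) • F + Hᗮ.starProjection W)
  have h2 : ‖(q : 𝕜) • F + Hᗮ.starProjection W‖ ≤ ‖(q : 𝕜) • F‖ + ‖W‖ :=
    (norm_add_le _ _).trans (add_le_add_right (Hᗮ.norm_starProjection_apply_le W) _)
  have h3 := div_le_div_of_nonneg_right h2 (show 0 ≤ q by linarith)
  rw [add_div] at h3
  rw [bOp, one_div_mul_eq_div]
  linarith

theorem tendsto_iterate_bOp (hτ : 0 ≤ τ) (hq : 1 < q) (W₁ : Matrix (Fin M) (Fin N) 𝕜) :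
    ∃ W₀ : Matrix (Fin M) (Fin N) 𝕜, Function.IsFixedPt (bOp H F τ q) W₀ ∧
      Tendsto (fun n : ℕ => (bOp H F τ q)^[n] W₁) atTop (𝓝 W₀) := by
  have : ProperSpace (Matrix (Fin M) (Fin N) 𝕜) := FiniteDimensional.proper_rclike 𝕜 _
  obtain ⟨Y, hY⟩ := exists_isFixedPt_bOp (H := H) (F := F) hτ hq
  exact exists_tendsto_iterate_of_nonexpansive (lipschitzWith_bOp hτ hq) hY W₁
    (asymptoticRegular_of_firmlyNonexpansive H (svCalculus_sFun_firmlyNonexpansive hτ hq) _ hY W₁)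

theorem inv_smul_sub_starProjection_mem (hF : F ∈ H) (r : 𝕜) (W : Matrix (Fin M) (Fin N) 𝕜) :
    r⁻¹ • ((q : 𝕜) • F - H.starProjection W) ∈ H :=
  H.smul_mem _ (H.sub_mem (H.smul_mem _ hF) (H.starProjection_apply_mem W))

/-- The strong convexity estimate at the point of `H` produced by a fixed point. -/
theorem objective_add_le_of_isFixedPt (hF : F ∈ H) (hτ : 0 ≤ τ) (hq : 1 < q)
    {W A : Matrix (Fin M) (Fin N) 𝕜} (hW : Function.IsFixedPt (bOp H F τ q) W)
    (hA : A = ((q - 1 : ℝ) : 𝕜)⁻¹ • ((q : 𝕜) • F - H.starProjection W))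
    {B : Matrix (Fin M) (Fin N) 𝕜} (hB : B ∈ H) :
    objective F τ q A + (q - 1) * ‖B - A‖ ^ 2 ≤ objective F τ q B := by
  have hAH : A ∈ H := hA ▸ inv_smul_sub_starProjection_mem hF _ W
  have hsplit := H.starProjection_add_starProjection_orthogonal W
  have hW' : svCalculus (sFun τ q) ((q : 𝕜) • F + Hᗮ.starProjection W) = W := hW
  have hA2 : A = (((q - 1)⁻¹ : ℝ) : 𝕜) • (((q : 𝕜) • F + Hᗮ.starProjection W) -
      svCalculus (sFun τ q) ((q : 𝕜) • F + Hᗮ.starProjection W)) := by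
    rw [hW', hA, RCLike.ofReal_inv, eq_sub_of_add_eq hsplit]
    congr 1
    abel
  have h1 := svCalculus_sFun_subgradient hτ hq hA2 B
  rw [hW'] at h1
  have hq0 : ((q - 1 : ℝ) : 𝕜) ≠ 0 := by
    exact_mod_cast (show q - 1 ≠ 0 by linarith)
  have hPW : H.starProjection W = (q : 𝕜) • F - ((q - 1 : ℝ) : 𝕜) • A := by
    rw [hA, smul_inv_smul₀ hq0, sub_sub_cancel]
  -- B - A lies in H, so the component of W in Hᗮ drops out.
  have h2 : inner 𝕜 W (B - A) = inner 𝕜 ((q : 𝕜) • F - ((q - 1 : ℝ) : 𝕜) • A) (B - A) := by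
    have h := Submodule.inner_left_of_mem_orthogonal (K := H) (H.sub_mem hB hAH)
      (Hᗮ.starProjection_apply_mem W)
    conv_lhs => rw [← hsplit, inner_add_left, h, add_zero, hPW]
  have h3 : RCLike.re (inner 𝕜 W (B - A)) =
      q * RCLike.re (inner 𝕜 F B) - q * RCLike.re (inner 𝕜 F A) -
        (q - 1) * RCLike.re (inner 𝕜 A B) + (q - 1) * ‖A‖ ^ 2 := by
    rw [h2, inner_sub_left, inner_smul_left, inner_smul_left, RCLike.conj_ofReal,
      RCLike.conj_ofReal, map_sub, RCLike.re_ofReal_mul, RCLike.re_ofReal_mul, inner_sub_right,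
      inner_sub_right, map_sub, map_sub, inner_self_eq_norm_sq (𝕜 := 𝕜)]
    ring
  have h4 : ‖B - A‖ ^ 2 = ‖B‖ ^ 2 - 2 * RCLike.re (inner 𝕜 A B) + ‖A‖ ^ 2 := by
    rw [norm_sub_sq (𝕜 := 𝕜), inner_re_symm]
  have h5 : ∀ C, ‖C - F‖ ^ 2 = ‖C‖ ^ 2 - 2 * RCLike.re (inner 𝕜 F C) + ‖F‖ ^ 2 := by
    intro C
    rw [norm_sub_sq (𝕜 := 𝕜), inner_re_symm]
  rw [objective, objective, h4, h5, h5]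
  rw [h3] at h1
  linarith

theorem isMinOn_of_isFixedPt (hF : F ∈ H) (hτ : 0 ≤ τ) (hq : 1 < q)
    {W A : Matrix (Fin M) (Fin N) 𝕜} (hW : Function.IsFixedPt (bOp H F τ q) W)
    (hA : A = ((q - 1 : ℝ) : 𝕜)⁻¹ • ((q : 𝕜) • F - H.starProjection W)) :
    A ∈ H ∧ IsMinOn (objective F τ q) H A ∧
      ∀ B ∈ H, IsMinOn (objective F τ q) H B → B = A := by
  have hAH : A ∈ H := hA ▸ inv_smul_sub_starProjection_mem hF _ W
  have key := fun B hB => objective_add_le_of_isFixedPt (B := B) hF hτ hq hW hA hB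
  refine ⟨hAH, fun B hB => ?_, fun B hB hmin => ?_⟩
  · have h := key B hB
    have : 0 ≤ (q - 1) * ‖B - A‖ ^ 2 := mul_nonneg (by linarith) (sq_nonneg _)
    change objective F τ q A ≤ objective F τ q B
    linarith
  · have h1 := key B hB
    have h2 : objective F τ q B ≤ objective F τ q A := hmin hAH
    have h3 : ‖B - A‖ ^ 2 = 0 := by nlinarith [sq_nonneg ‖B - A‖]
    exact sub_eq_zero.mp (norm_eq_zero.mp (pow_eq_zero_iff two_ne_zero |>.mp h3))

theorem starProjection_eq_of_isFixedPt (hF : F ∈ H) (hτ : 0 ≤ τ) (hq : 1 < q)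
    {W W' : Matrix (Fin M) (Fin N) 𝕜} (hW : Function.IsFixedPt (bOp H F τ q) W)
    (hW' : Function.IsFixedPt (bOp H F τ q) W') :
    H.starProjection W = H.starProjection W' := by
  obtain ⟨h1, h2, -⟩ := isMinOn_of_isFixedPt hF hτ hq hW rfl
  have h := (isMinOn_of_isFixedPt hF hτ hq hW' rfl).2.2 _ h1 h2
  have hq0 : ((q - 1 : ℝ) : 𝕜)⁻¹ ≠ 0 :=
    inv_ne_zero (by exact_mod_cast (show q - 1 ≠ 0 by linarith))
  exact sub_right_injective (smul_right_injective _ hq0 h)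

end Operator

theorem theorem5p1 {𝕜 : Type*} [RCLike 𝕜] {M N : ℕ}
    (H : Submodule 𝕜 (Matrix (Fin M) (Fin N) 𝕜)) (F : Matrix (Fin M) (Fin N) 𝕜) (hF : F ∈ H)
    (τ q : ℝ) (hτ : 0 < τ) (hq : 1 < q) :
    -- from any starting point, the Picard iteration converges to a fixed point
    (∀ W₁ : Matrix (Fin M) (Fin N) 𝕜, ∃ W₀ : Matrix (Fin M) (Fin N) 𝕜,
      Function.IsFixedPt (bOp H F τ q) W₀ ∧
        Tendsto (fun n : ℕ => (bOp H F τ q)^[n] W₁) atTop (𝓝 W₀)) ∧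
    -- the projection onto `H` is the same for all fixed points
    (∀ W₀ W₀' : Matrix (Fin M) (Fin N) 𝕜, Function.IsFixedPt (bOp H F τ q) W₀ →
      Function.IsFixedPt (bOp H F τ q) W₀' → H.starProjection W₀ = H.starProjection W₀') ∧
    -- every fixed point yields the unique minimizer of the objective over `H`
    (∀ W₀ A₀ : Matrix (Fin M) (Fin N) 𝕜, Function.IsFixedPt (bOp H F τ q) W₀ →
      A₀ = ((q - 1 : ℝ) : 𝕜)⁻¹ • ((q : 𝕜) • F - H.starProjection W₀) →
      A₀ ∈ H ∧ IsMinOn (objective F τ q) H A₀ ∧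
        ∀ A ∈ H, IsMinOn (objective F τ q) H A → A = A₀) := by
  exact ⟨tendsto_iterate_bOp hτ.le hq,
    fun _ _ hW hW' => starProjection_eq_of_isFixedPt hF hτ.le hq hW hW',
    fun _ _ hW hA => isMinOn_of_isFixedPt hF hτ.le hq hW hA⟩
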